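/- Let $\mathbb{C}^+=\{z\in\mathbb{C}:\Im z>0\}$. For a Borel probability measure $\nu$ on $\mathbb{R}$ put $G_\nu(z)=\int_{\mathbb{R}}\frac{1}{z-t}\,d\nu(t)$ and $F_\nu(z)=1/G_\nu(z)$ for $z\in\mathbb{C}^+$. The Voiculescu transform of $\nu$ is $\varphi_\nu(z)=F_\nu^{-1}(z)-z$, where $F_\nu^{-1}$ is the analytic right inverse of $F_\nu:\mathbb{C}^+\to\mathbb{C}^+$ with $F_\nu^{-1}(z)=z(1+o(1))$ at infinity, defined on the truncated cones $\{x+iy: y>M,\ |x|<\eta y\}$ (for every $\eta>0$ and $M=M(\eta,\nu)$ large enough). For $\gamma\in\mathbb{R}$ and a finite Borel measure $\sigma$ on $\mathbb{R}$, write $\nu=\nu_{\boxplus}^{\gamma,\sigma}$ (the freely infinitely divisible law with free generating pair $(\gamma,\sigma)$) if $$\varphi_\nu(z)=\gamma+\int_{\mathbb{R}}\frac{1+tz}{z-t}\,d\sigma(t)$$ on such truncated cones; the right-hand side then defines the analytic extension of $\varphi_\nu$ to $\mathbb{C}^+$. **Proposition 5.1.** Let $\nu=\nu_{\boxplus}^{\gamma,\sigma}$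 be nondegenerate, that is, not a point mass. Then $F_\nu$ extends continuously to $\mathbb{C}^+\cup\mathbb{R}$ (the extension is still denoted $F_\nu$), and with $$L=\int_{\mathbb{R}}\frac{1+t^2}{t^2}\,d\sigma(t)\in[0,\infty]$$ (the integrand being $\infty$ at $t=0$) the following hold. 1. One has $L=\sup_{\varepsilon>0}\frac{-\Im\varphi_\nu(i\varepsilon)}{\varepsilon}$, and $0\in F_\nu(\mathbb{R})$ if and only if $L\le 1$. In this case $\int_{\mathbb{R}}\frac{1}{|t|}\,d\sigma(t)<\infty$ and $F_\nu$ has exactly one zero on $\mathbb{R}$, namely $$t_\nu=\gamma-\int_{\mathbb{R}}\frac1t\,d\sigma(t).$$ 2. If $L\le 1$, then $\nu(\{t_\nu\})>0$ if and only if $L<1$, and in that case $\nu(\{t_\nu\})=1-L$. -/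

import Mathlib

open MeasureTheory Filter Topology

/-- The open upper half-plane `ℂ⁺`, as a subset of `ℂ`. -/
def openUpperHalfPlane : Set ℂ := {z : ℂ | 0 < z.im}

/-- The Cauchy transform `G_ν(z) = ∫ 1 / (z - t) dν(t)`, used for `z ∈ ℂ⁺`. -/
noncomputable def cauchyTransform (ν : Measure ℝ) (z : ℂ) : ℂ :=
  ∫ t : ℝ, 1 / (z - (t : ℂ)) ∂ν

/-- The reciprocal Cauchy transform `F_ν = 1 / G_ν` on `ℂ⁺`. -/
noncomputable def reciprocalCauchy (ν : Measure ℝ) (z : ℂ) : ℂ :=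
  1 / cauchyTransform ν z

/-- The extension of `F_ν` from `ℂ⁺` to `ℂ⁺ ∪ ℝ` by continuity: its value at `z` is the
limit of `F_ν(w)` as `w → z` with `w ∈ ℂ⁺`. -/
noncomputable def reciprocalCauchyExt (ν : Measure ℝ) : ℂ → ℂ :=
  extendFrom openUpperHalfPlane (reciprocalCauchy ν)

/-- The truncated cone `Γ_{η,M} = {x + iy : y > M, |x| < η y}`. -/
def truncatedCone (η M : ℝ) : Set ℂ := {z : ℂ | M < z.im ∧ |z.re| < η * z.im}

/-- `φ` is (on truncated cones at infinity) the Voiculescu transform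
`φ_ν(z) = F_ν⁻¹(z) - z` of `ν`: for every `η > 0` there is `M > 0` such that `z ↦ z + φ(z)` is
an analytic right inverse of `F_ν : ℂ⁺ → ℂ⁺` on `Γ_{η,M}`. The condition `φ(z) = o(|z|)` at
infinity in the cone singles out the branch of the inverse that is asymptotic to the identity;
other right inverses may exist, for instance for a two-point measure. -/
def IsVoiculescuTransform (ν : Measure ℝ) (φ : ℂ → ℂ) : Prop :=
  ∀ η : ℝ, 0 < η → ∃ M : ℝ, 0 < M ∧
    DifferentiableOn ℂ φ (truncatedCone η M) ∧
    (∀ z ∈ truncatedCone η M,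
      z + φ z ∈ openUpperHalfPlane ∧ reciprocalCauchy ν (z + φ z) = z) ∧
    Tendsto (fun z : ℂ => φ z / z) (Bornology.cobounded ℂ ⊓ 𝓟 (truncatedCone η M)) (𝓝 0)

/-- The free Lévy–Khintchine function `z ↦ γ + ∫ (1 + t z) / (z - t) dσ(t)` on `ℂ⁺`. -/
noncomputable def freeLevyKhintchine (γ : ℝ) (σ : Measure ℝ) (z : ℂ) : ℂ :=
  (γ : ℂ) + ∫ t : ℝ, (1 + (t : ℂ) * z) / (z - (t : ℂ)) ∂σ

/-- `(γ, σ)` is the free generating pair of `ν`, that is `ν = ν_⊞^{γ,σ}`: the Voiculescu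
transform of `ν` is the free Lévy–Khintchine function of the pair `(γ, σ)`. -/
def HasFreeGeneratingPair (ν : Measure ℝ) (γ : ℝ) (σ : Measure ℝ) : Prop :=
  IsVoiculescuTransform ν (freeLevyKhintchine γ σ)

/-- The singular integral `L = ∫ (1 + t²) / t² dσ(t) ∈ [0, ∞]`. The quotient is taken in
`[0, ∞]`, so the integrand is `∞` at `t = 0`. -/
noncomputable def singularIntegral (σ : Measure ℝ) : ENNReal :=
  ∫⁻ t : ℝ, ENNReal.ofReal (1 + t ^ 2) / ENNReal.ofReal (t ^ 2) ∂σ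

/-! Write H(z) = z + φ(z), m(z) = ∫ (1 + t²)/|z - t|² dσ and Q(z,w) = ∫ (1 + t²)/((z - t)(w - t))
dσ. Everything rests on H(z) - H(w) = (z - w)(1 - Q(z,w)) (`levyMap_sub`) and Im H(z) = Im z · (1 -
m(z)) (`levyMap_im`). Since |Q(z,w)| ≤ (m(z) + m(w))/2, H is injective on {m < 1}, the part of ℂ⁺
that it sends into ℂ⁺. The relation H ∘ F_ν = id spreads by analytic continuation from the image of
a cone to ℂ⁺, so F_ν is the inverse of H on {m < 1}.

Boundary extension: the bound on Q degenerates as m tends to 1, but Re Q falls short of (m(z) +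
m(w))/2 by a multiple of |z - w|². Hence |H(z) - H(w)| ≥ c|z - w|³ on bounded sets
(`cube_le_norm_levyMap_sub`), and F_ν is locally 1/3-Hölder.

Zeros: L is m(0). If F_ν(w) → 0, Fatou and m(F_ν(w)) < 1 give L ≤ 1. If L ≤ 1, then iε lies in {m <
1} and H(iε) → H(0) = t_ν, so F_ν(t_ν) = 0; the Lipschitz bound for H at 0 excludes other zeros.

Atoms: (w - x)G_ν(w) tends nontangentially to ν({x}). At x = H(0) and w = H(z) it is the difference
quotient of H at 0, whose nontangential limit is 1 - L. -/

/-- The kernel `(1 + t²) / |z - t|²`. -/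
noncomputable def levyKernel (z : ℂ) (t : ℝ) : ℝ := (1 + t ^ 2) / ‖z - t‖ ^ 2

/-- The integral of the kernel `(1 + t²) / |z - t|²` against `σ`. -/
noncomputable def levyMass (σ : Measure ℝ) (z : ℂ) : ℝ := ∫ t, levyKernel z t ∂σ

/-- Points at which the free Lévy–Khintchine integral and its derivative converge absolutely. -/
def IsRegularPoint (σ : Measure ℝ) (z : ℂ) : Prop :=
  (∀ᵐ t : ℝ ∂σ, z ≠ t) ∧ Integrable (levyKernel z) σ

/-- The map `z ↦ z + φ(z)`, where `φ` is the free Lévy–Khintchine function. -/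
noncomputable def levyMap (γ : ℝ) (σ : Measure ℝ) (z : ℂ) : ℂ := z + freeLevyKhintchine γ σ z

/-- The difference quotient kernel `∫ (1 + t²) / ((z - t) (w - t)) dσ(t)`. -/
noncomputable def levyQuotient (σ : Measure ℝ) (z w : ℂ) : ℂ :=
  ∫ t : ℝ, (1 + (t : ℂ) ^ 2) / ((z - t) * (w - t)) ∂σ

/-! ### Elementary bounds for the kernels -/

lemma isOpen_openUpperHalfPlane : IsOpen openUpperHalfPlane :=
  isOpen_lt continuous_const Complex.continuous_im

lemma im_le_norm_sub_ofReal (z : ℂ) (t : ℝ) : z.im ≤ ‖z - t‖ := by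
  have := Complex.abs_im_le_norm (z - t)
  simp only [Complex.sub_im, Complex.ofReal_im, sub_zero] at this
  exact (le_abs_self _).trans this

lemma norm_sub_ofReal_pos {z : ℂ} (hz : 0 < z.im) (t : ℝ) : 0 < ‖z - t‖ :=
  hz.trans_le (im_le_norm_sub_ofReal z t)

lemma sub_ofReal_ne_zero {z : ℂ} (hz : 0 < z.im) (t : ℝ) : z - t ≠ 0 :=
  norm_pos_iff.1 (norm_sub_ofReal_pos hz t)

lemma norm_sub_ofReal_sq (z : ℂ) (t : ℝ) : ‖z - t‖ ^ 2 = (z.re - t) ^ 2 + z.im ^ 2 := by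
  rw [Complex.sq_norm, Complex.normSq_apply]
  simp
  ring

lemma levyKernel_nonneg (z : ℂ) (t : ℝ) : 0 ≤ levyKernel z t := by
  unfold levyKernel; positivity

lemma measurable_levyKernel (z : ℂ) : Measurable (levyKernel z) := by
  unfold levyKernel; fun_prop

lemma levyMass_nonneg (σ : Measure ℝ) (z : ℂ) : 0 ≤ levyMass σ z :=
  integral_nonneg (levyKernel_nonneg z)

lemma levyKernel_le {z : ℂ} (hz : 0 < z.im) (t : ℝ) :
    levyKernel z t ≤ 2 + (1 + 2 * z.re ^ 2) / z.im ^ 2 := by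
  unfold levyKernel
  have h := norm_sub_ofReal_pos hz t
  rw [div_le_iff₀ (by positivity), norm_sub_ofReal_sq]
  have h1 : 0 ≤ (1 + 2 * z.re ^ 2) / z.im ^ 2 * (z.re - t) ^ 2 := by positivity
  have h2 : (1 + 2 * z.re ^ 2) / z.im ^ 2 * z.im ^ 2 = 1 + 2 * z.re ^ 2 := by
    field_simp
  nlinarith [sq_nonneg (2 * z.re - t), sq_nonneg z.im]

lemma isRegularPoint_of_im_pos (σ : Measure ℝ) [IsFiniteMeasure σ] {z : ℂ} (hz : 0 < z.im) :
    IsRegularPoint σ z := by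
  refine ⟨ae_of_all _ fun t => sub_ne_zero.1 (sub_ofReal_ne_zero hz t), ?_⟩
  refine Integrable.of_bound (measurable_levyKernel z).aestronglyMeasurable
    (2 + (1 + 2 * z.re ^ 2) / z.im ^ 2) (ae_of_all _ fun t => ?_)
  rw [Real.norm_of_nonneg (levyKernel_nonneg z t)]
  exact levyKernel_le hz t

lemma norm_one_add_ofReal_sq (t : ℝ) : ‖1 + (t : ℂ) ^ 2‖ = 1 + t ^ 2 := by
  have : (1 + (t : ℂ) ^ 2) = ((1 + t ^ 2 : ℝ) : ℂ) := by push_cast; ring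
  rw [this, Complex.norm_real, Real.norm_of_nonneg (by positivity)]

lemma norm_quotient_kernel_le (z w : ℂ) (t : ℝ) :
    ‖(1 + (t : ℂ) ^ 2) / ((z - t) * (w - t))‖ ≤ (levyKernel z t + levyKernel w t) / 2 := by
  rw [norm_div, norm_mul, norm_one_add_ofReal_sq]
  unfold levyKernel
  have h : 2 * (‖z - t‖⁻¹ * ‖w - t‖⁻¹) ≤ ‖z - t‖⁻¹ ^ 2 + ‖w - t‖⁻¹ ^ 2 := by
    nlinarith [sq_nonneg (‖z - t‖⁻¹ - ‖w - t‖⁻¹)]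
  have ht : 0 ≤ 1 + t ^ 2 := by positivity
  simp only [div_eq_mul_inv, mul_inv, ← inv_pow]
  nlinarith [mul_le_mul_of_nonneg_left h ht]

/-! ### The difference formula for H and its linear bounds -/

section Regular

variable {σ : Measure ℝ} {z w : ℂ}

lemma integrable_quotient_kernel (hz : IsRegularPoint σ z) (hw : IsRegularPoint σ w) :
    Integrable (fun t : ℝ => (1 + (t : ℂ) ^ 2) / ((z - t) * (w - t))) σ := by
  refine ((hz.2.add hw.2).div_const 2).mono' ?_
    (ae_of_all _ fun t => norm_quotient_kernel_le z w t)
  exact Measurable.aestronglyMeasurable (by fun_prop)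

lemma integrable_levyKhintchine_kernel [IsFiniteMeasure σ] (hz : IsRegularPoint σ z) :
    Integrable (fun t : ℝ => (1 + (t : ℂ) * z) / (z - t)) σ := by
  refine (((hz.2.const_mul (1 + ‖z‖) ).add (integrable_const (1 + ‖z‖)))).mono' ?_
    (ae_of_all _ fun t => ?_)
  · exact Measurable.aestronglyMeasurable (by fun_prop)
  · simp only [Pi.add_apply]
    rw [norm_div]
    have h1 : ‖1 + (t : ℂ) * z‖ ≤ (1 + ‖z‖) * (1 + |t|) := by
      refine (norm_add_le _ _).trans ?_
      rw [norm_mul, Complex.norm_real, norm_one, Real.norm_eq_abs]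
      nlinarith [norm_nonneg z, abs_nonneg t]
    have h2 : (1 + |t|) / ‖z - t‖ ≤ levyKernel z t + 1 := by
      unfold levyKernel
      rw [div_eq_mul_inv, div_eq_mul_inv, ← inv_pow, ← sq_abs t]
      nlinarith [sq_nonneg (‖z - t‖⁻¹ - 1), sq_nonneg (|t| * ‖z - t‖⁻¹ - 1),
        sq_nonneg (‖z - t‖⁻¹), sq_nonneg (|t| * ‖z - t‖⁻¹)]
    calc ‖1 + (t : ℂ) * z‖ / ‖z - t‖ ≤ (1 + ‖z‖) * (1 + |t|) / ‖z - t‖ := by gcongr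
      _ = (1 + ‖z‖) * ((1 + |t|) / ‖z - t‖) := by ring
      _ ≤ (1 + ‖z‖) * (levyKernel z t + 1) := by gcongr
      _ = _ := by ring

/-- Pointwise, the two integrands differ by -(z - w)(1 + t²)/((z - t)(w - t)). Regularity is all
that is used, so the real point 0 is allowed when L is finite. -/
lemma levyMap_sub [IsFiniteMeasure σ] (γ : ℝ) (hz : IsRegularPoint σ z)
    (hw : IsRegularPoint σ w) :
    levyMap γ σ z - levyMap γ σ w = (z - w) * (1 - levyQuotient σ z w) := by
  have h : (∫ t : ℝ, (1 + (t : ℂ) * z) / (z - t) ∂σ) - ∫ t : ℝ, (1 + (t : ℂ) * w) / (w - t) ∂σ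
      = -(z - w) * levyQuotient σ z w := by
    rw [levyQuotient, ← integral_sub (integrable_levyKhintchine_kernel hz)
      (integrable_levyKhintchine_kernel hw), ← integral_const_mul]
    refine integral_congr_ae ?_
    filter_upwards [hz.1, hw.1] with t h1 h2
    have h1' := sub_ne_zero.2 h1
    have h2' := sub_ne_zero.2 h2
    field_simp
    ring
  unfold levyMap freeLevyKhintchine
  linear_combination h

lemma norm_levyQuotient_le (hz : IsRegularPoint σ z) (hw : IsRegularPoint σ w) :
    ‖levyQuotient σ z w‖ ≤ (levyMass σ z + levyMass σ w) / 2 := by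
  unfold levyMass
  rw [← integral_add hz.2 hw.2, ← integral_div]
  exact norm_integral_le_of_norm_le ((hz.2.add hw.2).div_const 2)
    (ae_of_all _ fun t => norm_quotient_kernel_le z w t)

lemma norm_levyMap_sub_le [IsFiniteMeasure σ] (γ : ℝ) (hz : IsRegularPoint σ z)
    (hw : IsRegularPoint σ w) (hz1 : levyMass σ z ≤ 1) (hw1 : levyMass σ w ≤ 1) :
    ‖levyMap γ σ z - levyMap γ σ w‖ ≤ 2 * ‖z - w‖ := by
  rw [levyMap_sub γ hz hw, norm_mul, mul_comm]
  gcongr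
  refine (norm_sub_le _ _).trans ?_
  have := norm_levyQuotient_le hz hw
  rw [norm_one]
  linarith

lemma le_norm_levyMap_sub [IsFiniteMeasure σ] (γ : ℝ) (hz : IsRegularPoint σ z)
    (hw : IsRegularPoint σ w) :
    (1 - (levyMass σ z + levyMass σ w) / 2) * ‖z - w‖ ≤ ‖levyMap γ σ z - levyMap γ σ w‖ := by
  rw [levyMap_sub γ hz hw, norm_mul, mul_comm]
  gcongr
  have h1 := norm_levyQuotient_le hz hw
  have h2 := norm_sub_norm_le 1 (levyQuotient σ z w)
  rw [norm_one] at h2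
  linarith

end Regular

/-! ### The cubic lower bound for H -/

section Cubic

variable {σ : Measure ℝ} [IsFiniteMeasure σ]

/-- A positive lower bound for `(1 + t²) / (|z - t|² |w - t|²)` in the disc of radius `R`. -/
noncomputable def discKernel (R t : ℝ) : ℝ := (1 + t ^ 2) / (R + |t|) ^ 4

lemma discKernel_pos {R : ℝ} (hR : 1 ≤ R) (t : ℝ) : 0 < discKernel R t := by
  unfold discKernel; positivity

lemma integrable_discKernel {R : ℝ} (hR : 1 ≤ R) : Integrable (discKernel R) σ := by
  refine Integrable.of_bound (Measurable.aestronglyMeasurable ?_) 1 (ae_of_all _ fun t => ?_)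
  · unfold discKernel; fun_prop
  · rw [Real.norm_of_nonneg (discKernel_pos hR t).le]
    unfold discKernel
    rw [div_le_one (by positivity), ← sq_abs t]
    have h : 1 + |t| ^ 2 ≤ (R + |t|) ^ 2 := by nlinarith [abs_nonneg t]
    have h' : 1 ≤ (R + |t|) ^ 2 := by nlinarith [abs_nonneg t]
    nlinarith

lemma integral_discKernel_pos (hσ : σ ≠ 0) {R : ℝ} (hR : 1 ≤ R) :
    0 < ∫ t, discKernel R t ∂σ := by
  rw [integral_pos_iff_support_of_nonneg (fun t => (discKernel_pos hR t).le)
    (integrable_discKernel hR)]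
  have : Function.support (discKernel R) = Set.univ :=
    Set.eq_univ_of_forall fun t => (discKernel_pos hR t).ne'
  rw [this]
  exact Measure.measure_univ_pos.2 hσ

/-- With a = z - t and b = w - t, |a|² + |b|² - 2 Re(ab) = |a - b|² + 4 Im a Im b, and the last term
is positive in the upper half-plane. -/
lemma re_quotient_kernel_le {z w : ℂ} (hz : 0 < z.im) (hw : 0 < w.im) {R : ℝ} (hR : 1 ≤ R)
    (hzR : ‖z‖ ≤ R) (hwR : ‖w‖ ≤ R) (t : ℝ) :
    ((1 + (t : ℂ) ^ 2) / ((z - t) * (w - t))).re ≤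
      (levyKernel z t + levyKernel w t) / 2 - ‖z - w‖ ^ 2 / 2 * discKernel R t := by
  have hz0 := norm_sub_ofReal_pos hz t
  have hw0 := norm_sub_ofReal_pos hw t
  have bz : ‖z - t‖ ≤ R + |t| := (norm_sub_le _ _).trans (by
    rw [Complex.norm_real, Real.norm_eq_abs]; linarith)
  have bw : ‖w - t‖ ≤ R + |t| := (norm_sub_le _ _).trans (by
    rw [Complex.norm_real, Real.norm_eq_abs]; linarith)
  have hre : ((1 + (t : ℂ) ^ 2) / ((z - t) * (w - t))).re =
      (1 + t ^ 2) * (((z - t) * (w - t)).re / (‖z - t‖ ^ 2 * ‖w - t‖ ^ 2)) := by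
    have : (1 + (t : ℂ) ^ 2) / ((z - t) * (w - t)) =
        ((1 + t ^ 2 : ℝ) : ℂ) * ((z - t) * (w - t))⁻¹ := by
      push_cast; rw [div_eq_mul_inv]
    rw [this, Complex.re_ofReal_mul, Complex.inv_re, Complex.normSq_mul, Complex.sq_norm,
      Complex.sq_norm]
  have hdisc : discKernel R t ≤ (1 + t ^ 2) / (‖z - t‖ ^ 2 * ‖w - t‖ ^ 2) := by
    unfold discKernel
    gcongr
    calc ‖z - t‖ ^ 2 * ‖w - t‖ ^ 2 ≤ (R + |t|) ^ 2 * (R + |t|) ^ 2 := by gcongr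
      _ = _ := by ring
  have hkey : ‖z - w‖ ^ 2 ≤ ‖z - t‖ ^ 2 + ‖w - t‖ ^ 2 - 2 * ((z - t) * (w - t)).re := by
    rw [Complex.sq_norm (z - w), Complex.normSq_apply, norm_sub_ofReal_sq, norm_sub_ofReal_sq]
    simp
    nlinarith [mul_pos hz hw]
  have hsum : levyKernel z t + levyKernel w t =
      (‖z - t‖ ^ 2 + ‖w - t‖ ^ 2) * ((1 + t ^ 2) / (‖z - t‖ ^ 2 * ‖w - t‖ ^ 2)) := by
    unfold levyKernel
    field_simp
    ring
  rw [hre, hsum]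
  set D := (1 + t ^ 2) / (‖z - t‖ ^ 2 * ‖w - t‖ ^ 2) with hD
  have hD0 : 0 ≤ D := by positivity
  have : (1 + t ^ 2) * (((z - t) * (w - t)).re / (‖z - t‖ ^ 2 * ‖w - t‖ ^ 2)) =
      ((z - t) * (w - t)).re * D := by rw [hD]; ring
  rw [this]
  have h1 := mul_le_mul_of_nonneg_right hkey hD0
  have h2 := mul_le_mul_of_nonneg_left hdisc (sq_nonneg ‖z - w‖)
  nlinarith

lemma cube_le_norm_levyMap_sub (γ : ℝ) {z w : ℂ} (hz : 0 < z.im) (hw : 0 < w.im)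
    (hz1 : levyMass σ z ≤ 1) (hw1 : levyMass σ w ≤ 1) {R : ℝ} (hR : 1 ≤ R)
    (hzR : ‖z‖ ≤ R) (hwR : ‖w‖ ≤ R) :
    (∫ t, discKernel R t ∂σ) / 2 * ‖z - w‖ ^ 3 ≤ ‖levyMap γ σ z - levyMap γ σ w‖ := by
  have rz := isRegularPoint_of_im_pos σ hz
  have rw' := isRegularPoint_of_im_pos σ hw
  have hQ : (levyQuotient σ z w).re ≤
      (levyMass σ z + levyMass σ w) / 2 - ‖z - w‖ ^ 2 / 2 * ∫ t, discKernel R t ∂σ := by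
    unfold levyMass
    have hi := integrable_quotient_kernel rz rw'
    have e : (levyQuotient σ z w).re =
        ∫ t : ℝ, ((1 + (t : ℂ) ^ 2) / ((z - t) * (w - t))).re ∂σ := (integral_re hi).symm
    rw [← integral_add rz.2 rw'.2, ← integral_div, ← integral_const_mul, e, ← integral_sub]
    · refine integral_mono hi.re ?_ fun t => re_quotient_kernel_le hz hw hR hzR hwR t
      exact ((rz.2.add rw'.2).div_const 2).sub ((integrable_discKernel hR).const_mul _)
    · exact (rz.2.add rw'.2).div_const 2
    · exact (integrable_discKernel hR).const_mul _
  rw [levyMap_sub γ rz rw', norm_mul]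
  have h1 : ‖z - w‖ ^ 2 / 2 * (∫ t, discKernel R t ∂σ) ≤ ‖1 - levyQuotient σ z w‖ := by
    refine le_trans ?_ (Complex.re_le_norm _)
    rw [Complex.sub_re, Complex.one_re]
    linarith
  calc _ = ‖z - w‖ * (‖z - w‖ ^ 2 / 2 * (∫ t, discKernel R t ∂σ)) := by ring
    _ ≤ _ := by gcongr

end Cubic

/-! ### Imaginary part, injectivity and analyticity of H -/

lemma freeLevyKhintchine_im (γ : ℝ) (σ : Measure ℝ) [IsFiniteMeasure σ] {z : ℂ}
    (hz : 0 < z.im) : (freeLevyKhintchine γ σ z).im = -(z.im * levyMass σ z) := by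
  have hi := integrable_levyKhintchine_kernel (isRegularPoint_of_im_pos σ hz)
  have e : (∫ t : ℝ, (1 + (t : ℂ) * z) / (z - t) ∂σ).im =
      ∫ t : ℝ, ((1 + (t : ℂ) * z) / (z - t)).im ∂σ := (integral_im hi).symm
  unfold freeLevyKhintchine levyMass
  rw [Complex.add_im, Complex.ofReal_im, zero_add, e, ← integral_const_mul, ← integral_neg]
  refine integral_congr_ae (ae_of_all _ fun t => ?_)
  have h0 := norm_sub_ofReal_pos hz t
  have h2 := norm_sub_ofReal_sq z t
  simp only [levyKernel, Complex.div_im, ← Complex.sq_norm]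
  rw [← sub_div, ← mul_div_assoc, ← neg_div]
  congr 1
  simp
  ring

lemma levyMap_im (γ : ℝ) (σ : Measure ℝ) [IsFiniteMeasure σ] {z : ℂ} (hz : 0 < z.im) :
    (levyMap γ σ z).im = z.im * (1 - levyMass σ z) := by
  rw [levyMap, Complex.add_im, freeLevyKhintchine_im γ σ hz]
  ring

lemma levyMap_im_pos_iff (γ : ℝ) (σ : Measure ℝ) [IsFiniteMeasure σ] {z : ℂ} (hz : 0 < z.im) :
    0 < (levyMap γ σ z).im ↔ levyMass σ z < 1 := by
  rw [levyMap_im γ σ hz, mul_pos_iff_of_pos_left hz, sub_pos]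

lemma levyMap_injOn (γ : ℝ) (σ : Measure ℝ) [IsFiniteMeasure σ] :
    Set.InjOn (levyMap γ σ) {z | 0 < z.im ∧ levyMass σ z < 1} := by
  rintro z ⟨hz, hz1⟩ w ⟨hw, hw1⟩ h
  have := le_norm_levyMap_sub γ (isRegularPoint_of_im_pos σ hz) (isRegularPoint_of_im_pos σ hw)
  rw [h, sub_self, norm_zero] at this
  have h2 : ‖z - w‖ ≤ 0 := by
    by_contra! hc
    nlinarith
  exact sub_eq_zero.1 (norm_le_zero_iff.1 h2)

lemma integrable_cauchyKernel (μ : Measure ℝ) [IsFiniteMeasure μ] {z : ℂ} (hz : 0 < z.im) :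
    Integrable (fun t : ℝ => 1 / (z - (t : ℂ))) μ := by
  refine Integrable.of_bound (Measurable.aestronglyMeasurable (by fun_prop)) (1 / z.im)
    (ae_of_all _ fun t => ?_)
  rw [norm_div, norm_one]
  exact one_div_le_one_div_of_le hz (im_le_norm_sub_ofReal z t)

lemma differentiableAt_cauchyTransform (μ : Measure ℝ) [IsFiniteMeasure μ] {z : ℂ}
    (hz : 0 < z.im) : DifferentiableAt ℂ (cauchyTransform μ) z := by
  have hs : {w : ℂ | z.im / 2 < w.im} ∈ 𝓝 z :=
    (isOpen_lt continuous_const Complex.continuous_im).mem_nhds (by simp; linarith)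
  refine (hasDerivAt_integral_of_dominated_loc_of_deriv_le (μ := μ)
    (F := fun (w : ℂ) (t : ℝ) => 1 / (w - (t : ℂ))) (F' := fun w t => -1 / (w - (t : ℂ)) ^ 2)
    (bound := fun _ => 1 / (z.im / 2) ^ 2) hs ?_ (integrable_cauchyKernel μ hz) ?_ ?_
    (integrable_const _) ?_).2.differentiableAt
  · exact .of_forall fun w => Measurable.aestronglyMeasurable (by fun_prop)
  · exact Measurable.aestronglyMeasurable (by fun_prop)
  · refine ae_of_all _ fun t w hw => ?_
    rw [norm_div, norm_neg, norm_one, norm_pow]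
    have h1 : z.im / 2 < w.im := hw
    have h2 := im_le_norm_sub_ofReal w t
    have h3 : 0 < z.im / 2 := by positivity
    gcongr
    linarith
  · refine ae_of_all _ fun t w hw => ?_
    have h1 : z.im / 2 < w.im := hw
    have hne := sub_ofReal_ne_zero (z := w) (by linarith) t
    simpa [one_div] using ((hasDerivAt_id w).sub_const (t : ℂ)).fun_inv hne

/-- Since (1 + tz)/(z - t) = (1 + z²)/(z - t) - z, analyticity of φ reduces to that of a Cauchy
transform. -/
lemma freeLevyKhintchine_eq (γ : ℝ) (σ : Measure ℝ) [IsFiniteMeasure σ] {z : ℂ}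
    (hz : 0 < z.im) : freeLevyKhintchine γ σ z =
      γ + ((1 + z ^ 2) * cauchyTransform σ z - z * (σ.real Set.univ : ℂ)) := by
  have hc : ∫ _ : ℝ, z ∂σ = z * (σ.real Set.univ : ℂ) := by
    rw [integral_const, mul_comm]; rfl
  rw [freeLevyKhintchine, cauchyTransform, ← integral_const_mul, ← hc, ← integral_sub
    ((integrable_cauchyKernel σ hz).const_mul _) (integrable_const _)]
  congr 1
  refine integral_congr_ae (ae_of_all _ fun t => ?_)
  have := sub_ofReal_ne_zero hz t
  field_simp
  ring

lemma differentiableAt_levyMap (γ : ℝ) (σ : Measure ℝ) [IsFiniteMeasure σ] {z : ℂ}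
    (hz : 0 < z.im) : DifferentiableAt ℂ (levyMap γ σ) z := by
  have h := differentiableAt_cauchyTransform σ hz
  have : DifferentiableAt ℂ (fun z => z + ((γ : ℂ) +
      ((1 + z ^ 2) * cauchyTransform σ z - z * (σ.real Set.univ : ℂ)))) z := by fun_prop
  refine this.congr_of_eventuallyEq ?_
  filter_upwards [isOpen_openUpperHalfPlane.mem_nhds hz] with w hw
  rw [levyMap, freeLevyKhintchine_eq γ σ hw]

/-! ### F_ν as the inverse of H, and its boundary values -/

section Reciprocal

variable (ν : Measure ℝ) [IsProbabilityMeasure ν]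

lemma cauchyTransform_im_neg {z : ℂ} (hz : 0 < z.im) : (cauchyTransform ν z).im < 0 := by
  have hi := integrable_cauchyKernel ν hz
  have e : (cauchyTransform ν z).im = ∫ t : ℝ, (1 / (z - (t : ℂ))).im ∂ν :=
    (integral_im hi).symm
  have hpt : ∀ t : ℝ, 0 < -(1 / (z - (t : ℂ))).im := fun t => by
    have h0 := norm_sub_ofReal_pos hz t
    rw [one_div, Complex.inv_im, ← Complex.sq_norm, neg_div, neg_neg, Complex.sub_im,
      Complex.ofReal_im, sub_zero]
    positivity
  rw [e, ← neg_pos, ← integral_neg,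
    integral_pos_iff_support_of_nonneg (fun t => (hpt t).le) hi.im.neg]
  have : Function.support (fun t : ℝ => -(1 / (z - (t : ℂ))).im) = Set.univ :=
    Set.eq_univ_of_forall fun t => (hpt t).ne'
  rw [this]
  exact Measure.measure_univ_pos.2 (IsProbabilityMeasure.ne_zero ν)

lemma cauchyTransform_ne_zero {z : ℂ} (hz : 0 < z.im) : cauchyTransform ν z ≠ 0 := fun h => by
  have := cauchyTransform_im_neg ν hz
  simp [h] at this

lemma reciprocalCauchy_im_pos {z : ℂ} (hz : 0 < z.im) : 0 < (reciprocalCauchy ν z).im := by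
  rw [reciprocalCauchy, one_div, Complex.inv_im]
  exact div_pos (neg_pos.2 (cauchyTransform_im_neg ν hz))
    (Complex.normSq_pos.2 (cauchyTransform_ne_zero ν hz))

lemma differentiableAt_reciprocalCauchy {z : ℂ} (hz : 0 < z.im) :
    DifferentiableAt ℂ (reciprocalCauchy ν) z :=
  (differentiableAt_const 1).div (differentiableAt_cauchyTransform ν hz)
    (cauchyTransform_ne_zero ν hz)

variable {ν} {γ : ℝ} {σ : Measure ℝ} [IsFiniteMeasure σ]

lemma isOpen_truncatedCone (η M : ℝ) : IsOpen (truncatedCone η M) :=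
  (isOpen_lt continuous_const Complex.continuous_im).inter
    (isOpen_lt (continuous_abs.comp Complex.continuous_re)
      (continuous_const.mul Complex.continuous_im))

/-- `z + φ(z)` is a left inverse of `F_ν` on the whole upper half-plane. -/
lemma levyMap_reciprocalCauchy (hpair : HasFreeGeneratingPair ν γ σ) {w : ℂ} (hw : 0 < w.im) :
    levyMap γ σ (reciprocalCauchy ν w) = w := by
  obtain ⟨M, hM, -, hinv, -⟩ := hpair 1 one_pos
  set z₀ : ℂ := (2 * M : ℝ) * Complex.I with hz₀
  have him : z₀.im = 2 * M := by simp [hz₀]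
  have hz₀M : z₀ ∈ truncatedCone 1 M := by
    constructor
    · rw [him]; linarith
    · rw [him]; simp [hz₀]; exact hM
  have hz₀p : 0 < z₀.im := by rw [him]; linarith
  have hmem : ∀ z ∈ truncatedCone 1 M, levyMap γ σ z ∈ openUpperHalfPlane ∧
      reciprocalCauchy ν (levyMap γ σ z) = z := hinv
  have hdiff : DifferentiableOn ℂ (fun w => levyMap γ σ (reciprocalCauchy ν w))
      openUpperHalfPlane := fun w hw =>
    ((differentiableAt_levyMap γ σ (reciprocalCauchy_im_pos ν hw)).comp w
      (differentiableAt_reciprocalCauchy ν hw)).differentiableWithinAt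
  have hconv : Convex ℝ openUpperHalfPlane := convex_halfSpace_im_gt 0
  -- H has the left inverse F_ν on the cone, hence is injective there and preserves punctured
  -- neighbourhoods. The points H(z) thus accumulate at H(z₀), as the identity theorem requires.
  have hH : Tendsto (levyMap γ σ) (𝓝[≠] z₀) (𝓝[≠] (levyMap γ σ z₀)) := by
    refine tendsto_nhdsWithin_of_tendsto_nhds_of_eventually_within _
      ((differentiableAt_levyMap γ σ hz₀p).continuousAt.tendsto.mono_left nhdsWithin_le_nhds) ?_
    filter_upwards [nhdsWithin_le_nhds ((isOpen_truncatedCone 1 M).mem_nhds hz₀M),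
      self_mem_nhdsWithin] with z hz hne h
    refine hne ?_
    have := (hmem z hz).2
    rw [h, (hmem z₀ hz₀M).2] at this
    exact this.symm
  have hfreq : ∃ᶠ w in 𝓝[≠] (levyMap γ σ z₀), levyMap γ σ (reciprocalCauchy ν w) = w := by
    refine hH.frequently (Eventually.frequently ?_)
    filter_upwards [nhdsWithin_le_nhds ((isOpen_truncatedCone 1 M).mem_nhds hz₀M)] with z hz
    rw [(hmem z hz).2]
  exact (hdiff.analyticOnNhd isOpen_openUpperHalfPlane).eqOn_of_preconnected_of_frequently_eq
    analyticOnNhd_id hconv.isPreconnected (hmem z₀ hz₀M).1 hfreq hw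

lemma levyMass_reciprocalCauchy_lt (hpair : HasFreeGeneratingPair ν γ σ) {w : ℂ}
    (hw : 0 < w.im) : levyMass σ (reciprocalCauchy ν w) < 1 := by
  rw [← levyMap_im_pos_iff γ σ (reciprocalCauchy_im_pos ν hw),
    levyMap_reciprocalCauchy hpair hw]
  exact hw

lemma im_le_reciprocalCauchy_im (hpair : HasFreeGeneratingPair ν γ σ) {w : ℂ}
    (hw : 0 < w.im) : w.im ≤ (reciprocalCauchy ν w).im := by
  have h0 := reciprocalCauchy_im_pos ν hw
  have h := levyMap_im γ σ h0
  rw [levyMap_reciprocalCauchy hpair hw] at h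
  nlinarith [levyMass_nonneg σ (reciprocalCauchy ν w)]

/-- `F_ν` is the inverse of `z + φ(z)` on the domain where the latter has positive imaginary
part. -/
lemma reciprocalCauchy_levyMap (hpair : HasFreeGeneratingPair ν γ σ) {z : ℂ} (hz : 0 < z.im)
    (hz1 : levyMass σ z < 1) : reciprocalCauchy ν (levyMap γ σ z) = z := by
  have hw := (levyMap_im_pos_iff γ σ hz).2 hz1
  exact levyMap_injOn γ σ ⟨reciprocalCauchy_im_pos ν hw, levyMass_reciprocalCauchy_lt hpair hw⟩
    ⟨hz, hz1⟩ (levyMap_reciprocalCauchy hpair hw)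

/-- Anchoring one point at F_ν(i), where the mass k is a fixed number below 1, keeps the linear
factor at least (1 - k)/2. This provides the local boundedness on which the cubic constant depends.
-/
lemma exists_norm_reciprocalCauchy_sub_le (hpair : HasFreeGeneratingPair ν γ σ) :
    ∃ C : ℝ, ∀ w : ℂ, 0 < w.im →
      ‖reciprocalCauchy ν w - reciprocalCauchy ν Complex.I‖ ≤ C * ‖w - Complex.I‖ := by
  have hI : 0 < Complex.I.im := by simp
  have h1 := levyMass_reciprocalCauchy_lt hpair hI
  set k := levyMass σ (reciprocalCauchy ν Complex.I)
  refine ⟨2 / (1 - k), fun w hw => ?_⟩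
  have h2 := levyMass_reciprocalCauchy_lt hpair hw
  have h := le_norm_levyMap_sub γ (isRegularPoint_of_im_pos σ (reciprocalCauchy_im_pos ν hw))
    (isRegularPoint_of_im_pos σ (reciprocalCauchy_im_pos ν hI))
  rw [levyMap_reciprocalCauchy hpair hw, levyMap_reciprocalCauchy hpair hI] at h
  have h3 : 0 < 1 - k := by linarith
  rw [div_mul_eq_mul_div, le_div_iff₀ h3]
  nlinarith [norm_nonneg (reciprocalCauchy ν w - reciprocalCauchy ν Complex.I)]

lemma exists_tendsto_reciprocalCauchy (hpair : HasFreeGeneratingPair ν γ σ) (hσ : σ ≠ 0)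
    {x : ℂ} (hx : 0 ≤ x.im) :
    ∃ y, Tendsto (reciprocalCauchy ν) (𝓝[openUpperHalfPlane] x) (𝓝 y) := by
  obtain ⟨C, hC⟩ := exists_norm_reciprocalCauchy_sub_le hpair
  have hxc : x ∈ closure openUpperHalfPlane := by
    have : closure openUpperHalfPlane = {z : ℂ | 0 ≤ z.im} := Complex.closure_setOfPred_lt_im 0
    rw [this]
    exact hx
  have := mem_closure_iff_nhdsWithin_neBot.1 hxc
  set R : ℝ := 1 + ‖reciprocalCauchy ν Complex.I‖ + |C| * (1 + ‖x - Complex.I‖) with hR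
  have hR1 : 1 ≤ R := by
    have : 0 ≤ |C| * (1 + ‖x - Complex.I‖) := by positivity
    linarith [norm_nonneg (reciprocalCauchy ν Complex.I)]
  have hbd : ∀ w ∈ Metric.ball x 1 ∩ openUpperHalfPlane, ‖reciprocalCauchy ν w‖ ≤ R := by
    rintro w ⟨hwx, hw⟩
    rw [Metric.mem_ball, dist_eq_norm] at hwx
    have h1 := hC w hw
    have h2 : ‖w - Complex.I‖ ≤ 1 + ‖x - Complex.I‖ := by
      have := norm_add_le (w - x) (x - Complex.I)
      rw [sub_add_sub_cancel] at this
      linarith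
    have h3 : C * ‖w - Complex.I‖ ≤ |C| * (1 + ‖x - Complex.I‖) :=
      mul_le_mul (le_abs_self C) h2 (norm_nonneg _) (abs_nonneg C)
    have h4 := norm_sub_norm_le (reciprocalCauchy ν w) (reciprocalCauchy ν Complex.I)
    linarith
  have hc := integral_discKernel_pos hσ hR1
  set c := (∫ t, discKernel R t ∂σ) / 2 with hcdef
  have hc0 : 0 < c := by positivity
  rw [← cauchy_map_iff_exists_tendsto, Metric.cauchy_iff]
  refine ⟨map_neBot, fun ε hε => ?_⟩
  -- Two points of the δ-ball are less than cε³ apart; δ ≤ 1 keeps them where |F_ν| ≤ R.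
  set δ := min 1 (c * ε ^ 3 / 2) with hδ
  have hδ0 : 0 < δ := by positivity
  refine ⟨reciprocalCauchy ν '' (Metric.ball x δ ∩ openUpperHalfPlane),
    image_mem_map (inter_mem (nhdsWithin_le_nhds (Metric.ball_mem_nhds x hδ0)) self_mem_nhdsWithin), ?_⟩
  rintro _ ⟨w₁, ⟨hw₁x, hw₁⟩, rfl⟩ _ ⟨w₂, ⟨hw₂x, hw₂⟩, rfl⟩
  have hb : ∀ w ∈ Metric.ball x δ, w ∈ Metric.ball x 1 := fun w hw =>
    Metric.ball_subset_ball (min_le_left _ _) hw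
  have h := cube_le_norm_levyMap_sub γ (reciprocalCauchy_im_pos ν hw₁)
    (reciprocalCauchy_im_pos ν hw₂) (levyMass_reciprocalCauchy_lt hpair hw₁).le
    (levyMass_reciprocalCauchy_lt hpair hw₂).le hR1 (hbd w₁ ⟨hb _ hw₁x, hw₁⟩)
    (hbd w₂ ⟨hb _ hw₂x, hw₂⟩)
  rw [levyMap_reciprocalCauchy hpair hw₁, levyMap_reciprocalCauchy hpair hw₂] at h
  have h5 : ‖w₁ - w₂‖ < c * ε ^ 3 := by
    rw [← dist_eq_norm]
    have h6 := dist_triangle_right w₁ w₂ x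
    have h7 : δ ≤ c * ε ^ 3 / 2 := min_le_right _ _
    rw [Metric.mem_ball] at hw₁x hw₂x
    linarith
  rw [dist_eq_norm]
  exact lt_of_pow_lt_pow_left₀ 3 hε.le (lt_of_mul_lt_mul_left (h.trans_lt h5) hc0.le)

end Reciprocal

/-! ### Behaviour at the origin: L, slopes and atoms -/

section AtZero

variable {σ : Measure ℝ} {ι : Type*} {l : Filter ι} [l.IsCountablyGenerated]

lemma ofReal_levyKernel {z : ℂ} {t : ℝ} (h : z ≠ t) : ENNReal.ofReal (levyKernel z t) =
    ENNReal.ofReal (1 + t ^ 2) / ENNReal.ofReal (‖z - t‖ ^ 2) :=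
  ENNReal.ofReal_div_of_pos (pow_pos (norm_pos_iff.2 (sub_ne_zero.2 h)) 2)

lemma ofReal_levyMass {z : ℂ} (hz : IsRegularPoint σ z) : ENNReal.ofReal (levyMass σ z) =
    ∫⁻ t : ℝ, ENNReal.ofReal (1 + t ^ 2) / ENNReal.ofReal (‖z - t‖ ^ 2) ∂σ := by
  rw [levyMass, ofReal_integral_eq_lintegral_ofReal hz.2 (ae_of_all _ (levyKernel_nonneg z))]
  exact lintegral_congr_ae (hz.1.mono fun t h => ofReal_levyKernel h)

lemma norm_zero_sub_ofReal_sq (t : ℝ) : ‖(0 : ℂ) - t‖ ^ 2 = t ^ 2 := by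
  rw [zero_sub, norm_neg, Complex.norm_real, Real.norm_eq_abs, sq_abs]

lemma isRegularPoint_zero (h : singularIntegral σ ≠ ⊤) : IsRegularPoint σ 0 := by
  have hm : Measurable fun t : ℝ => ENNReal.ofReal (1 + t ^ 2) / ENNReal.ofReal (t ^ 2) := by
    fun_prop
  have h0 : ∀ᵐ t : ℝ ∂σ, (0 : ℂ) ≠ t := by
    -- Finiteness of L excludes an atom of σ at 0, where the integrand is ∞.
    filter_upwards [ae_lt_top hm h] with t ht h0
    have : t = 0 := by exact_mod_cast h0.symm
    simp [this] at ht
  refine ⟨h0, (measurable_levyKernel 0).aestronglyMeasurable, ?_⟩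
  rw [hasFiniteIntegral_iff_ofReal (ae_of_all _ (levyKernel_nonneg 0)), lt_top_iff_ne_top]
  convert h using 1
  refine lintegral_congr_ae (h0.mono fun t ht => ?_)
  simp only [ofReal_levyKernel ht, norm_zero_sub_ofReal_sq]

lemma ofReal_levyMass_zero (h : singularIntegral σ ≠ ⊤) :
    ENNReal.ofReal (levyMass σ 0) = singularIntegral σ := by
  rw [ofReal_levyMass (isRegularPoint_zero h)]
  simp only [norm_zero_sub_ofReal_sq, singularIntegral]

/-- Fatou's lemma, with no restriction on the direction of approach. Quotients in [0, ∞] make the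
pointwise limit correct at t = 0 too. -/
lemma singularIntegral_le_of_tendsto [IsFiniteMeasure σ] [l.NeBot] {z : ι → ℂ}
    (hz : ∀ᶠ i in l, 0 < (z i).im) (hlim : Tendsto z l (𝓝 0)) {c : ENNReal}
    (hc : ∀ᶠ i in l, ENNReal.ofReal (levyMass σ (z i)) ≤ c) : singularIntegral σ ≤ c := by
  have hpt : ∀ t : ℝ, Tendsto
      (fun i => ENNReal.ofReal (1 + t ^ 2) / ENNReal.ofReal (‖z i - t‖ ^ 2)) l
      (𝓝 (ENNReal.ofReal (1 + t ^ 2) / ENNReal.ofReal (t ^ 2))) := fun t => by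
    refine ENNReal.Tendsto.div tendsto_const_nhds (.inl ?_) ?_ (.inl ENNReal.ofReal_ne_top)
    · exact (ENNReal.ofReal_pos.2 (by positivity)).ne'
    · rw [← norm_zero_sub_ofReal_sq t]
      exact ENNReal.tendsto_ofReal (((hlim.sub_const _).norm).pow 2)
  have hle := lintegral_liminf_le (μ := σ) (u := l)
    (f := fun i (t : ℝ) => ENNReal.ofReal (1 + t ^ 2) / ENNReal.ofReal (‖z i - t‖ ^ 2))
    fun i => by fun_prop
  simp only [(hpt _).liminf_eq] at hle
  refine hle.trans (liminf_le_of_frequently_le' (Eventually.frequently ?_))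
  filter_upwards [hz, hc] with i hi hci
  rwa [← ofReal_levyMass (isRegularPoint_of_im_pos σ hi)]

/-- The kernels at 0 and iε differ by ε²(1 + t²)/(t²(t² + ε²)). The explicit gap gives m(iε) < 1
even in the critical case L = 1. -/
lemma levyMass_mul_I_le [IsFiniteMeasure σ] (h : IsRegularPoint σ 0) {ε : ℝ} (hε : 0 < ε) :
    levyMass σ (ε * Complex.I) + ε ^ 2 * ∫ t, discKernel (1 + ε) t ∂σ ≤ levyMass σ 0 := by
  have hR : 1 ≤ 1 + ε := by linarith
  have hr : IsRegularPoint σ (ε * Complex.I) := isRegularPoint_of_im_pos σ (by simpa using hε)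
  unfold levyMass
  rw [← integral_const_mul, ← integral_add hr.2 ((integrable_discKernel hR).const_mul _)]
  refine integral_mono_ae (hr.2.add ((integrable_discKernel hR).const_mul _)) h.2 ?_
  filter_upwards [h.1] with t ht
  have ht0 : t ≠ 0 := fun h => ht (by simp [h])
  have ht2 : 0 < t ^ 2 := by positivity
  have e1 : levyKernel (ε * Complex.I) t = (1 + t ^ 2) / (t ^ 2 + ε ^ 2) := by
    rw [levyKernel, norm_sub_ofReal_sq]
    simp
  have e2 : levyKernel 0 t = (1 + t ^ 2) / t ^ 2 := by
    rw [levyKernel, norm_zero_sub_ofReal_sq]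
  have e3 : levyKernel 0 t - levyKernel (ε * Complex.I) t =
      ε ^ 2 * ((1 + t ^ 2) / (t ^ 2 * (t ^ 2 + ε ^ 2))) := by
    rw [e1, e2]
    field_simp
    ring
  have e4 : discKernel (1 + ε) t ≤ (1 + t ^ 2) / (t ^ 2 * (t ^ 2 + ε ^ 2)) := by
    unfold discKernel
    gcongr
    have a1 : t ^ 2 ≤ (1 + ε + |t|) ^ 2 := by
      rw [← sq_abs t]; gcongr; linarith
    have a2 : t ^ 2 + ε ^ 2 ≤ (1 + ε + |t|) ^ 2 := by
      rw [← sq_abs t]; nlinarith [abs_nonneg t, mul_nonneg hε.le (abs_nonneg t)]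
    calc t ^ 2 * (t ^ 2 + ε ^ 2) ≤ (1 + ε + |t|) ^ 2 * (1 + ε + |t|) ^ 2 := by gcongr
      _ = _ := by ring
  have := mul_le_mul_of_nonneg_left e4 (sq_nonneg ε)
  linarith

lemma levyMass_mul_I_le_levyMass_zero [IsFiniteMeasure σ] (h : IsRegularPoint σ 0) {ε : ℝ}
    (hε : 0 < ε) : levyMass σ (ε * Complex.I) ≤ levyMass σ 0 := by
  have h1 := levyMass_mul_I_le h hε
  have h2 : 0 ≤ ∫ t, discKernel (1 + ε) t ∂σ :=
    integral_nonneg fun t => (discKernel_pos (by linarith) t).le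
  nlinarith [mul_nonneg (sq_nonneg ε) h2]

lemma levyMass_mul_I_lt_one [IsFiniteMeasure σ] (hσ : σ ≠ 0) (h : IsRegularPoint σ 0)
    (h1 : levyMass σ 0 ≤ 1) {ε : ℝ} (hε : 0 < ε) : levyMass σ (ε * Complex.I) < 1 := by
  have h2 := levyMass_mul_I_le h hε
  have h3 := mul_pos (pow_pos hε 2) (integral_discKernel_pos hσ (R := 1 + ε) (by linarith))
  linarith

lemma ofReal_levyMass_mul_I_le (σ : Measure ℝ) [IsFiniteMeasure σ] {ε : ℝ} (hε : 0 < ε) :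
    ENNReal.ofReal (levyMass σ (ε * Complex.I)) ≤ singularIntegral σ := by
  by_cases h : singularIntegral σ = ⊤
  · rw [h]; exact le_top
  · rw [← ofReal_levyMass_zero h]
    exact ENNReal.ofReal_le_ofReal (levyMass_mul_I_le_levyMass_zero (isRegularPoint_zero h) hε)

lemma tendsto_mul_I : Tendsto (fun ε : ℝ => (ε : ℂ) * Complex.I) (𝓝[>] 0) (𝓝 0) := by
  have : Continuous fun ε : ℝ => (ε : ℂ) * Complex.I := by fun_prop
  simpa using (this.tendsto 0).mono_left nhdsWithin_le_nhds

lemma iSup_neg_freeLevyKhintchine_im (γ : ℝ) (σ : Measure ℝ) [IsFiniteMeasure σ] :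
    (⨆ ε : Set.Ioi (0 : ℝ),
      ((-(freeLevyKhintchine γ σ (((ε : ℝ) : ℂ) * Complex.I)).im / (ε : ℝ) : ℝ) : EReal))
      = (singularIntegral σ : EReal) := by
  have e : ∀ ε : Set.Ioi (0 : ℝ),
      ((-(freeLevyKhintchine γ σ (((ε : ℝ) : ℂ) * Complex.I)).im / (ε : ℝ) : ℝ) : EReal) =
      (ENNReal.ofReal (levyMass σ ((ε : ℝ) * Complex.I)) : EReal) := by
    rintro ⟨ε, hε⟩
    have hε' : (0 : ℝ) < ε := hε
    have him : ((ε : ℂ) * Complex.I).im = ε := by simp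
    rw [EReal.coe_ennreal_ofReal, max_eq_left (levyMass_nonneg _ _),
      freeLevyKhintchine_im γ σ (him.symm ▸ hε'), him, neg_neg, mul_div_cancel_left₀ _ hε'.ne']
  simp only [e]
  refine le_antisymm (iSup_le fun ε => ?_) ?_
  · exact EReal.coe_ennreal_le_coe_ennreal_iff.2 (ofReal_levyMass_mul_I_le σ ε.2)
  · set s := ⨆ ε : Set.Ioi (0 : ℝ),
      (ENNReal.ofReal (levyMass σ ((ε : ℝ) * Complex.I)) : EReal)
    have hs : ∀ ε : ℝ, 0 < ε → (ENNReal.ofReal (levyMass σ (ε * Complex.I)) : EReal) ≤ s :=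
      fun ε hε => le_iSup (fun ε : Set.Ioi (0 : ℝ) =>
        (ENNReal.ofReal (levyMass σ ((ε : ℝ) * Complex.I)) : EReal)) ⟨ε, hε⟩
    have hs0 : 0 ≤ s := (EReal.coe_ennreal_nonneg _).trans (hs 1 one_pos)
    rw [← EReal.coe_toENNReal hs0, EReal.coe_ennreal_le_coe_ennreal_iff]
    refine singularIntegral_le_of_tendsto (l := 𝓝[>] (0 : ℝ)) ?_ tendsto_mul_I ?_
    · filter_upwards [self_mem_nhdsWithin] with ε hε
      simpa using hε
    · filter_upwards [self_mem_nhdsWithin] with ε hε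
      rw [← EReal.coe_ennreal_le_coe_ennreal_iff, EReal.coe_toENNReal hs0]
      exact hs ε hε

lemma levyQuotient_zero_zero (σ : Measure ℝ) :
    levyQuotient σ 0 0 = (levyMass σ 0 : ℂ) := by
  unfold levyQuotient levyMass
  rw [← integral_complex_ofReal]
  congr 1
  ext t
  rw [levyKernel, norm_zero_sub_ofReal_sq]
  push_cast
  congr 1
  ring

lemma tendsto_levyQuotient_zero (h : IsRegularPoint σ 0) {z : ι → ℂ} {K : ℝ}
    (hz : ∀ᶠ i in l, 0 < (z i).im) (hK : ∀ᶠ i in l, ‖z i‖ ≤ K * (z i).im)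
    (hlim : Tendsto z l (𝓝 0)) :
    Tendsto (fun i => levyQuotient σ (z i) 0) l (𝓝 (levyMass σ 0)) := by
  rw [← levyQuotient_zero_zero]
  refine tendsto_integral_filter_of_dominated_convergence
    (fun t => (1 + |K|) * levyKernel 0 t) ?_ ?_ (h.2.const_mul _) ?_
  · exact .of_forall fun i => Measurable.aestronglyMeasurable (by fun_prop)
  · filter_upwards [hz, hK] with i hi hKi
    filter_upwards [h.1] with t ht
    have ht0 : t ≠ 0 := fun h => ht (by simp [h])
    have h0 := norm_sub_ofReal_pos hi t
    have hn : ‖(0 : ℂ) - t‖ = |t| := by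
      rw [zero_sub, norm_neg, Complex.norm_real, Real.norm_eq_abs]
    rw [norm_div, norm_mul, norm_one_add_ofReal_sq, levyKernel, hn]
    have hta : 0 < |t| := abs_pos.2 ht0
    -- Nontangential approach gives |t| ≤ |z| + |z - t| ≤ (1 + |K|)|z - t|, so the kernel at 0
    -- dominates.
    have h1 : |t| ≤ (1 + |K|) * ‖z i - t‖ := by
      have a1 : |t| ≤ ‖z i‖ + ‖z i - t‖ := by
        have := norm_sub_le (z i) (z i - t)
        rwa [sub_sub_cancel, Complex.norm_real, Real.norm_eq_abs] at this
      have a2 : K * (z i).im ≤ |K| * ‖z i - t‖ :=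
        mul_le_mul (le_abs_self K) (im_le_norm_sub_ofReal _ _) hi.le (abs_nonneg K)
      linarith
    rw [← mul_div_assoc, div_le_div_iff₀ (by positivity) (by positivity)]
    have hp : 0 ≤ (1 + t ^ 2) * |t| := by positivity
    nlinarith [mul_le_mul_of_nonneg_left h1 hp]
  · filter_upwards [h.1] with t ht
    refine Tendsto.div tendsto_const_nhds ((hlim.sub_const _).mul_const _) ?_
    exact mul_ne_zero (sub_ne_zero.2 ht) (sub_ne_zero.2 ht)

/-- The nontangential derivative of `z + φ(z)` at the origin is `1 - L`. -/
lemma tendsto_levyMap_slope_zero [IsFiniteMeasure σ] (γ : ℝ) (h : IsRegularPoint σ 0)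
    {z : ι → ℂ} {K : ℝ}
    (hz : ∀ᶠ i in l, 0 < (z i).im) (hK : ∀ᶠ i in l, ‖z i‖ ≤ K * (z i).im)
    (hlim : Tendsto z l (𝓝 0)) :
    Tendsto (fun i => (levyMap γ σ (z i) - levyMap γ σ 0) / z i) l
      (𝓝 (1 - (levyMass σ 0 : ℂ))) := by
  refine ((tendsto_levyQuotient_zero h hz hK hlim).const_sub 1).congr' ?_
  filter_upwards [hz] with i hi
  have : z i ≠ 0 := fun h => by simp [h] at hi
  rw [levyMap_sub γ (isRegularPoint_of_im_pos σ hi) h, sub_zero, mul_div_cancel_left₀ _ this]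

/-- The nontangential limit of `(w - x) G_ν(w)` at `x` is the mass of `{x}`. -/
lemma tendsto_sub_mul_cauchyTransform (ν : Measure ℝ) [IsFiniteMeasure ν] (x : ℝ)
    {w : ι → ℂ} {K : ℝ}
    (hw : ∀ᶠ i in l, 0 < (w i).im) (hK : ∀ᶠ i in l, ‖w i - x‖ ≤ K * (w i).im)
    (hlim : Tendsto w l (𝓝 x)) :
    Tendsto (fun i => (w i - x) * cauchyTransform ν (w i)) l (𝓝 (ν.real {x} : ℂ)) := by
  have e : (ν.real {x} : ℂ) = ∫ t : ℝ, ({x} : Set ℝ).indicator (fun _ => (1 : ℂ)) t ∂ν := by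
    rw [integral_indicator_const _ (measurableSet_singleton x)]
    simp
  rw [e]
  have e' : ∀ i, (w i - x) * cauchyTransform ν (w i) =
      ∫ t : ℝ, (w i - x) * (1 / (w i - (t : ℂ))) ∂ν := fun i =>
    (integral_const_mul _ _).symm
  simp only [e']
  refine tendsto_integral_filter_of_dominated_convergence (fun _ => |K|) ?_ ?_
    (integrable_const _) ?_
  · exact .of_forall fun i => Measurable.aestronglyMeasurable (by fun_prop)
  · filter_upwards [hw, hK] with i hi hKi
    refine ae_of_all _ fun t => ?_
    have h0 := norm_sub_ofReal_pos hi t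
    rw [norm_mul, norm_div, norm_one, mul_one_div, div_le_iff₀ h0]
    exact hKi.trans (mul_le_mul (le_abs_self K) (im_le_norm_sub_ofReal _ _) hi.le (abs_nonneg K))
  · refine ae_of_all _ fun t => ?_
    by_cases ht : t = x
    · subst ht
      simp only [Set.mem_singleton_iff, Set.indicator_of_mem]
      refine tendsto_const_nhds.congr' ?_
      filter_upwards [hw] with i hi
      rw [mul_one_div, div_self (sub_ofReal_ne_zero hi t)]
    · rw [Set.indicator_of_notMem (by simpa using ht)]
      have hne : (x : ℂ) - t ≠ 0 := sub_ne_zero.2 (by exact_mod_cast Ne.symm ht)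
      have := (hlim.sub_const (x : ℂ)).mul
        ((tendsto_const_nhds (x := (1 : ℂ))).div (hlim.sub_const (t : ℂ)) hne)
      simpa using this

lemma integrable_one_div [IsFiniteMeasure σ] (h : IsRegularPoint σ 0) :
    Integrable (fun t : ℝ => 1 / t) σ := by
  refine h.2.mono' (Measurable.aestronglyMeasurable (by fun_prop)) ?_
  filter_upwards [h.1] with t ht
  have ht0 : t ≠ 0 := fun h => ht (by simp [h])
  have hta : 0 < |t| := abs_pos.2 ht0
  rw [levyKernel, norm_zero_sub_ofReal_sq, norm_div, norm_one, Real.norm_eq_abs, ← sq_abs t,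
    div_le_div_iff₀ hta (by positivity)]
  nlinarith [sq_nonneg (|t| - 1), mul_nonneg hta.le (sq_nonneg (|t| - 1))]

/-- No integrability is needed: if 1/t is not integrable, both integrals are 0 by convention. -/
lemma levyMap_zero (γ : ℝ) (σ : Measure ℝ) :
    levyMap γ σ 0 = ((γ - ∫ t : ℝ, 1 / t ∂σ : ℝ) : ℂ) := by
  have : ∫ t : ℝ, (1 + (t : ℂ) * 0) / (0 - (t : ℂ)) ∂σ = -((∫ t : ℝ, 1 / t ∂σ : ℝ) : ℂ) := by
    rw [← integral_complex_ofReal, ← integral_neg]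
    congr 1
    ext t
    push_cast
    rw [mul_zero, add_zero, zero_sub, div_neg]
  rw [levyMap, freeLevyKhintchine, this]
  push_cast
  ring

end AtZero

/-! ### The mass of the atom at H(0) -/

section Atom

variable {ν : Measure ℝ} [IsProbabilityMeasure ν] {γ : ℝ} {σ : Measure ℝ} [IsFiniteMeasure σ]

lemma norm_levyMap_sub_levyMap_zero_le (γ : ℝ) (h : IsRegularPoint σ 0)
    (h1 : levyMass σ 0 ≤ 1) {w : ℂ} (hw : 0 < w.im) (hw1 : levyMass σ w < 1) :
    ‖levyMap γ σ w - levyMap γ σ 0‖ ≤ 2 * ‖w‖ := by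
  simpa using norm_levyMap_sub_le γ (isRegularPoint_of_im_pos σ hw) h hw1.le h1

/-- Along w = H(iε), G_ν(w) = 1/(iε), so (w - x)G_ν(w) is exactly the slope of H at 0. The two limit
theorems evaluate this one quantity as ν({x}) and as 1 - m(0). -/
lemma measureReal_eq_of_levyMass_lt_one (hpair : HasFreeGeneratingPair ν γ σ)
    (h : IsRegularPoint σ 0) (h1 : levyMass σ 0 < 1) {x : ℝ} (hx : levyMap γ σ 0 = x) :
    ν.real {x} = 1 - levyMass σ 0 := by
  set z : ℝ → ℂ := fun ε => (ε : ℂ) * Complex.I with hzdef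
  have him : ∀ ε : ℝ, (z ε).im = ε := fun ε => by simp [z]
  have hnorm : ∀ ε : ℝ, 0 < ε → ‖z ε‖ = ε := fun ε hε => by simp [z, abs_of_pos hε]
  have hpos : ∀ᶠ ε in 𝓝[>] (0 : ℝ), 0 < ε := self_mem_nhdsWithin
  have hmass : ∀ ε : ℝ, 0 < ε → levyMass σ (z ε) ≤ levyMass σ 0 := fun ε hε =>
    levyMass_mul_I_le_levyMass_zero h hε
  have hlip : ∀ ε : ℝ, 0 < ε → ‖levyMap γ σ (z ε) - x‖ ≤ 2 * ε := fun ε hε => by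
    have hi : 0 < (z ε).im := by rw [him]; exact hε
    have := norm_levyMap_sub_levyMap_zero_le γ h h1.le hi ((hmass ε hε).trans_lt h1)
    rwa [hx, hnorm ε hε] at this
  have hHim : ∀ ε : ℝ, 0 < ε → ε * (1 - levyMass σ 0) ≤ (levyMap γ σ (z ε)).im :=
    fun ε hε => by
      rw [levyMap_im γ σ (by rw [him]; exact hε), him]
      have := hmass ε hε
      gcongr
  have hw : ∀ᶠ ε in 𝓝[>] (0 : ℝ), 0 < (levyMap γ σ (z ε)).im := hpos.mono fun ε hε =>
    (mul_pos hε (sub_pos.2 h1)).trans_le (hHim ε hε)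
  have hlim : Tendsto (fun ε => levyMap γ σ (z ε)) (𝓝[>] 0) (𝓝 (x : ℂ)) := by
    rw [tendsto_iff_norm_sub_tendsto_zero]
    refine squeeze_zero' (.of_forall fun ε => norm_nonneg _) (hpos.mono hlip) ?_
    have : Continuous fun ε : ℝ => 2 * ε := by fun_prop
    simpa using (this.tendsto 0).mono_left (nhdsWithin_le_nhds (s := Set.Ioi 0))
  -- The approach is nontangential because |w - x| ≤ 2ε and Im w ≥ ε(1 - m(0)); this is where m(0) <
  -- 1 enters.
  have hatom := tendsto_sub_mul_cauchyTransform ν x (K := 2 / (1 - levyMass σ 0)) hw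
    (hpos.mono fun ε hε => by
      refine (hlip ε hε).trans ?_
      rw [div_mul_eq_mul_div, le_div_iff₀ (sub_pos.2 h1), mul_assoc]
      exact mul_le_mul_of_nonneg_left (hHim ε hε) zero_le_two) hlim
  have hslope := tendsto_levyMap_slope_zero γ h (l := 𝓝[>] (0 : ℝ)) (z := z) (K := 1)
    (hpos.mono fun ε hε => by rw [him]; exact hε)
    (hpos.mono fun ε hε => by rw [him, one_mul, hnorm ε hε]) tendsto_mul_I
  have heq := tendsto_nhds_unique_of_eventuallyEq hatom hslope (hpos.mono fun ε hε => by
    have hF := reciprocalCauchy_levyMap hpair (z := z ε) (by rw [him]; exact hε)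
      ((hmass ε hε).trans_lt h1)
    have hG : cauchyTransform ν (levyMap γ σ (z ε)) = 1 / z ε := by
      simpa [reciprocalCauchy] using congrArg (·⁻¹) hF
    simp only
    rw [hG, hx, mul_one_div])
  exact_mod_cast heq

/-- Here x is approached vertically and the slope is taken along F_ν(w). A positive atom makes
F_ν(w) tend to 0 nontangentially, so again ν({x}) = 1 - m(0). -/
lemma levyMass_lt_one_of_measureReal_pos (hpair : HasFreeGeneratingPair ν γ σ)
    (h : IsRegularPoint σ 0) {x : ℝ} (hx : levyMap γ σ 0 = x)
    (hpos : 0 < ν.real {x}) : levyMass σ 0 < 1 := by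
  set w : ℝ → ℂ := fun ε => x + (ε : ℂ) * Complex.I with hwdef
  set c : ℂ := (ν.real {x} : ℂ) with hc
  have hc0 : c ≠ 0 := by rw [hc]; exact_mod_cast hpos.ne'
  have him : ∀ ε : ℝ, (w ε).im = ε := fun ε => by simp [w]
  have hsub : ∀ ε : ℝ, w ε - x = ε * Complex.I := fun ε => by simp [w]
  have hsubnorm : ∀ ε : ℝ, 0 < ε → ‖w ε - x‖ = ε := fun ε hε => by
    rw [hsub]; simp [abs_of_pos hε]
  have hev : ∀ᶠ ε in 𝓝[>] (0 : ℝ), 0 < ε := self_mem_nhdsWithin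
  have hw : ∀ᶠ ε in 𝓝[>] (0 : ℝ), 0 < (w ε).im := hev.mono fun ε hε => by rw [him]; exact hε
  have hw0 : Tendsto (fun ε => w ε - x) (𝓝[>] 0) (𝓝 0) := by
    simp only [hsub]; exact tendsto_mul_I
  have hlim : Tendsto w (𝓝[>] 0) (𝓝 (x : ℂ)) := tendsto_sub_nhds_zero_iff.1 hw0
  have hatom := tendsto_sub_mul_cauchyTransform ν x (K := 1) hw
    (hev.mono fun ε hε => by rw [him, one_mul, hsubnorm ε hε]) hlim
  have hdiv : Tendsto (fun ε => (w ε - x) / reciprocalCauchy ν (w ε)) (𝓝[>] 0) (𝓝 c) := by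
    simpa only [reciprocalCauchy, div_div_eq_mul_div, div_one] using hatom
  have hF0 : Tendsto (fun ε => reciprocalCauchy ν (w ε)) (𝓝[>] 0) (𝓝 0) := by
    have := hw0.div hdiv hc0
    rw [zero_div] at this
    refine this.congr' (hev.mono fun ε hε => ?_)
    have : w ε - x ≠ 0 := norm_pos_iff.1 (by rw [hsubnorm ε hε]; exact hε)
    simp only [Pi.div_apply]
    rw [div_div_cancel₀ this]
  -- Eventually ε/|F_ν(w)| > |c|/2, while Im F_ν(w) ≥ Im w = ε.
  have hnt : ∀ᶠ ε in 𝓝[>] (0 : ℝ), ‖reciprocalCauchy ν (w ε)‖ ≤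
      2 / ‖c‖ * (reciprocalCauchy ν (w ε)).im := by
    have hcn : 0 < ‖c‖ := norm_pos_iff.2 hc0
    filter_upwards [hev, hw, hdiv.norm.eventually_const_lt (half_lt_self hcn)] with ε hε hwε hd
    have hF := reciprocalCauchy_im_pos ν hwε
    have hFn : 0 < ‖reciprocalCauchy ν (w ε)‖ := norm_pos_iff.2 fun h => by simp [h] at hF
    have hle := im_le_reciprocalCauchy_im hpair hwε
    rw [him] at hle
    rw [norm_div, hsubnorm ε hε, lt_div_iff₀ hFn] at hd
    rw [div_mul_eq_mul_div, le_div_iff₀ hcn]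
    linarith
  have hslope := tendsto_levyMap_slope_zero γ h (l := 𝓝[>] (0 : ℝ))
    (z := fun ε => reciprocalCauchy ν (w ε))
    (hw.mono fun ε hε => reciprocalCauchy_im_pos ν hε) hnt hF0
  have heq := tendsto_nhds_unique_of_eventuallyEq hdiv hslope (hw.mono fun ε hε => by
    simp only
    rw [levyMap_reciprocalCauchy hpair hε, hx])
  have : ν.real {x} = 1 - levyMass σ 0 := by rw [hc] at heq; exact_mod_cast heq
  linarith

/-- For σ = 0 the atom formula gives mass 1 at γ, so ν would be a point mass. -/
lemma ne_zero_of_forall_ne_dirac (hpair : HasFreeGeneratingPair ν γ σ)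
    (hnondeg : ∀ a : ℝ, ν ≠ Measure.dirac a) : σ ≠ 0 := by
  rintro rfl
  have hr : IsRegularPoint (0 : Measure ℝ) 0 := ⟨by simp, integrable_zero_measure⟩
  have hm : levyMass 0 0 = 0 := integral_zero_measure _
  have h := measureReal_eq_of_levyMass_lt_one hpair hr (by rw [hm]; exact one_pos)
    (levyMap_zero γ 0)
  set x := γ - ∫ t : ℝ, 1 / t ∂(0 : Measure ℝ)
  rw [hm, sub_zero, measureReal_def, ENNReal.toReal_eq_one_iff] at h
  refine hnondeg x ?_
  have hae : ∀ᵐ t ∂ν, t = x := (prob_compl_eq_zero_iff (measurableSet_singleton x)).2 h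
  ext s hs
  have : s =ᵐ[ν] {_t | x ∈ s} := hae.mono fun t ht => by
    subst ht
    rfl
  rw [measure_congr this, Measure.dirac_apply' _ hs]
  by_cases hxs : x ∈ s <;> simp [hxs]

end Atom

/-! ### Proof of the proposition -/

theorem proposition5p1 (ν : Measure ℝ) [IsProbabilityMeasure ν]
    (γ : ℝ) (σ : Measure ℝ) [IsFiniteMeasure σ]
    (hpair : HasFreeGeneratingPair ν γ σ)
    (hnondeg : ∀ a : ℝ, ν ≠ Measure.dirac a) :
    -- `F_ν` extends continuously to the closed upper half-plane
    ContinuousOn (reciprocalCauchyExt ν) {z : ℂ | 0 ≤ z.im} ∧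
    Set.EqOn (reciprocalCauchyExt ν) (reciprocalCauchy ν) openUpperHalfPlane ∧
    -- the two expressions for `L`
    (⨆ ε : Set.Ioi (0 : ℝ),
        ((-(freeLevyKhintchine γ σ (((ε : ℝ) : ℂ) * Complex.I)).im / (ε : ℝ) : ℝ) : EReal))
      = (singularIntegral σ : EReal) ∧
    -- `0 ∈ F_ν(ℝ)` if and only if `L ≤ 1`
    ((0 : ℂ) ∈ Set.range (fun x : ℝ => reciprocalCauchyExt ν (x : ℂ)) ↔
      singularIntegral σ ≤ 1) ∧
    -- in this case the unique zero is `t_ν = γ - ∫ 1/t dσ(t)`, the integral being convergent,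
    -- and `t_ν` is an atom if and only if `L < 1`
    (singularIntegral σ ≤ 1 →
      Integrable (fun t : ℝ => 1 / t) σ ∧
      (∀ x : ℝ, reciprocalCauchyExt ν (x : ℂ) = 0 ↔ x = γ - ∫ t : ℝ, 1 / t ∂σ) ∧
      (0 < ν {γ - ∫ t : ℝ, 1 / t ∂σ} ↔ singularIntegral σ < 1)) ∧
    -- the mass of the atom
    (singularIntegral σ < 1 →
      ν {γ - ∫ t : ℝ, 1 / t ∂σ} = 1 - singularIntegral σ) := by
  have hσ := ne_zero_of_forall_ne_dirac hpair hnondeg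
  have hcl : {z : ℂ | 0 ≤ z.im} = closure openUpperHalfPlane :=
    (Complex.closure_setOfPred_lt_im 0).symm
  have hext : ∀ z : ℂ, 0 ≤ z.im → Tendsto (reciprocalCauchy ν) (𝓝[openUpperHalfPlane] z)
      (𝓝 (reciprocalCauchyExt ν z)) := fun z hz =>
    tendsto_extendFrom (exists_tendsto_reciprocalCauchy hpair hσ hz)
  have hcont : ContinuousOn (reciprocalCauchy ν) openUpperHalfPlane := fun z hz =>
    (differentiableAt_reciprocalCauchy ν hz).continuousAt.continuousWithinAt
  have hneBot : ∀ x : ℝ, (𝓝[openUpperHalfPlane] (x : ℂ)).NeBot := fun x =>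
    mem_closure_iff_nhdsWithin_neBot.1 (by rw [← hcl]; simp)
  set T := γ - ∫ t : ℝ, 1 / t ∂σ with hT
  have hT0 : levyMap γ σ 0 = T := levyMap_zero γ σ
  have hzero : ∀ x : ℝ, reciprocalCauchyExt ν x = 0 →
      Tendsto (reciprocalCauchy ν) (𝓝[openUpperHalfPlane] (x : ℂ)) (𝓝 0) := fun x hx => by
    rw [← hx]
    exact hext x (by simp)
  have hmem : ∀ x : ℝ, ∀ᶠ w in 𝓝[openUpperHalfPlane] (x : ℂ), 0 < w.im := fun x =>
    self_mem_nhdsWithin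
  have hle : ∀ x : ℝ, reciprocalCauchyExt ν x = 0 → singularIntegral σ ≤ 1 := fun x hx => by
    have := hneBot x
    refine singularIntegral_le_of_tendsto
      ((hmem x).mono fun w hw => reciprocalCauchy_im_pos ν hw) (hzero x hx)
      ((hmem x).mono fun w hw => ?_)
    rw [← ENNReal.ofReal_one]
    exact ENNReal.ofReal_le_ofReal (levyMass_reciprocalCauchy_lt hpair hw).le
  have hreg : singularIntegral σ ≤ 1 → IsRegularPoint σ 0 ∧ levyMass σ 0 ≤ 1 ∧
      ENNReal.ofReal (levyMass σ 0) = singularIntegral σ := fun hL => by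
    have htop := ne_top_of_le_ne_top ENNReal.one_ne_top hL
    refine ⟨isRegularPoint_zero htop, ?_, ofReal_levyMass_zero htop⟩
    rw [← ofReal_levyMass_zero htop] at hL
    exact ENNReal.ofReal_le_one.1 hL
  have huniq : ∀ x : ℝ, reciprocalCauchyExt ν x = 0 → x = T := fun x hx => by
    obtain ⟨h0, h1, -⟩ := hreg (hle x hx)
    have := hneBot x
    -- As w = H(F_ν(w)), the Lipschitz bound at 0 gives |w - T| ≤ 2|F_ν(w)| → 0, while also w → x.
    have hlim : Tendsto (fun w : ℂ => w) (𝓝[openUpperHalfPlane] (x : ℂ)) (𝓝 (T : ℂ)) := by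
      rw [tendsto_iff_norm_sub_tendsto_zero]
      refine squeeze_zero' (.of_forall fun w => norm_nonneg _) ((hmem x).mono fun w hw => ?_)
        (g := fun w => 2 * ‖reciprocalCauchy ν w‖) ?_
      · have := norm_levyMap_sub_levyMap_zero_le γ h0 h1 (reciprocalCauchy_im_pos ν hw)
          (levyMass_reciprocalCauchy_lt hpair hw)
        rwa [levyMap_reciprocalCauchy hpair hw, hT0] at this
      · simpa using (hzero x hx).norm.const_mul 2
    have := tendsto_nhds_unique (tendsto_id.mono_left nhdsWithin_le_nhds) hlim
    exact_mod_cast this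
  have hroot : singularIntegral σ ≤ 1 → reciprocalCauchyExt ν T = 0 := fun hL => by
    obtain ⟨h0, h1, -⟩ := hreg hL
    have hpos : ∀ᶠ ε in 𝓝[>] (0 : ℝ), 0 < ε := self_mem_nhdsWithin
    have him : ∀ ε : ℝ, 0 < ε → 0 < ((ε : ℂ) * Complex.I).im := fun ε hε => by simpa using hε
    have hmass := fun (ε : ℝ) (hε : 0 < ε) => levyMass_mul_I_lt_one hσ h0 h1 hε
    -- The curve H(iε) reaches T inside ℂ⁺ and F_ν(H(iε)) = iε there, so the existing limit of F_ν
    -- at T must be 0.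
    have hH : Tendsto (fun ε : ℝ => levyMap γ σ (ε * Complex.I)) (𝓝[>] 0)
        (𝓝[openUpperHalfPlane] (T : ℂ)) := by
      refine tendsto_nhdsWithin_iff.2 ⟨?_, hpos.mono fun ε hε =>
        (levyMap_im_pos_iff γ σ (him ε hε)).2 (hmass ε hε)⟩
      rw [tendsto_iff_norm_sub_tendsto_zero]
      refine squeeze_zero' (.of_forall fun w => norm_nonneg _) (hpos.mono fun ε hε => ?_)
        (g := fun ε : ℝ => 2 * ‖(ε : ℂ) * Complex.I‖) ?_
      · rw [← hT0]
        exact norm_levyMap_sub_levyMap_zero_le γ h0 h1 (him ε hε) (hmass ε hε)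
      · simpa using tendsto_mul_I.norm.const_mul 2
    refine tendsto_nhds_unique_of_eventuallyEq ((hext T (by simp)).comp hH) tendsto_mul_I
      (hpos.mono fun ε hε => ?_)
    exact reciprocalCauchy_levyMap hpair (him ε hε) (hmass ε hε)
  have hatom : singularIntegral σ < 1 → ν {T} = 1 - singularIntegral σ := fun hL => by
    obtain ⟨h0, -, h2⟩ := hreg hL.le
    have h1 : levyMass σ 0 < 1 := by
      rwa [← h2, ← ENNReal.ofReal_one, ENNReal.ofReal_lt_ofReal_iff one_pos] at hL
    rw [← h2, ← ENNReal.ofReal_one, ← ENNReal.ofReal_sub _ (levyMass_nonneg _ _),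
      ← measureReal_eq_of_levyMass_lt_one hpair h0 h1 hT0, ofReal_measureReal]
  refine ⟨hcl ▸ continuousOn_extendFrom subset_rfl fun z hz =>
      exists_tendsto_reciprocalCauchy hpair hσ (hcl.symm ▸ hz : z ∈ {z : ℂ | 0 ≤ z.im}),
    extendFrom_extends hcont, iSup_neg_freeLevyKhintchine_im γ σ,
    ⟨fun ⟨x, hx⟩ => hle x hx, fun hL => ⟨T, hroot hL⟩⟩, fun hL => ?_, hatom⟩
  obtain ⟨h0, -, h2⟩ := hreg hL
  refine ⟨integrable_one_div h0, fun x => ⟨huniq x, fun hx => hx ▸ hroot hL⟩, fun hpos => ?_,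
    fun hlt => ?_⟩
  · rw [← h2, ← ENNReal.ofReal_one, ENNReal.ofReal_lt_ofReal_iff one_pos]
    exact levyMass_lt_one_of_measureReal_pos hpair h0 hT0
      (ENNReal.toReal_pos hpos.ne' (measure_ne_top _ _))
  · rw [hatom hlt]
    exact tsub_pos_of_lt hlt
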